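/- Let $G$ be a finite graph with vertex set $V(G)$ and edge set $E(G)$ (loops and parallel edges are allowed). For $C\subseteq E(G)$ let $G\langle C\rangle$ be the subgraph of $G$ formed by the edges in $C$ and their end vertices. For $k\ge 1$ let $M_k(G)$, the $k$-circular matroid of $G$, be the matroid on $E(G)$ whose circuits are the sets $C\subseteq E(G)$ such that $|C|-|V(G\langle C\rangle)|=k$ and $G\langle C\rangle$ has no isolated vertices, no vertices of degree one (a loop contributes two to the degree), and no connected component that is a cycle. Let $\rho_k^*(G)$ denote the corank of $M_k(G)$, i.e. the rank of its dual matroid. A matroid is connected if it has no loops, no coloops, and every two of its elements belong to a common circuit; a cocircuit $K$ of a connected matroid $M$ is non-separating if $M\setminus K$ is connected. The star of a vertex $x$ is the set of all edges incident to $x$. The graph $G$ is $3$-connected if $|V(G)|\ge 4$ and $G\setminus X$ is connected for every $X\subseteq V(G)$ with $|X|\le 2$. **Theorem.** Let $G$ be a finite $3$-connected graph, let $k\ge 1$, and suppose that $|E(G)|-|V(G)|\ge k$. Then the set of non-separating cocircuits of $M_k(G)$ is equal to the set of those vertex stars $S$ of $G$ for which $|S|\le\rho_k^*(G)$. -/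

import Mathlib

open scoped Graph Matroid

namespace KCircular

variable {α β : Type*}

/-- The degree of a vertex: the number of incident edges, a loop being counted twice. -/
noncomputable def degree (G : Graph α β) (x : α) : ℕ∞ :=
  (G.incidenceSet x).encard + (G.loopSet x).encard

/-- A graph is connected if it has a vertex and any two of its vertices are joined by a walk. -/
def Connected (G : Graph α β) : Prop :=
  V(G).Nonempty ∧ ∀ x ∈ V(G), ∀ y ∈ V(G), Relation.ReflTransGen G.Adj x y

/-- A graph is `3`-connected if it has at least four vertices and stays connected after the
deletion of any set of at most two vertices (loops and parallel edges are not forbidden). -/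
def IsThreeConnected (G : Graph α β) : Prop :=
  4 ≤ V(G).encard ∧ ∀ X ⊆ V(G), X.encard ≤ 2 → Connected (G.deleteVerts X)

/-- `H` is a connected component of `G`. -/
def IsComponent (H G : Graph α β) : Prop :=
  H ≤c G ∧ Connected H

/-- A (finite) graph is a cycle if it is connected and `2`-regular. A single loop and a pair of
parallel edges are the cycles of length one and two. -/
def IsCycle (H : Graph α β) : Prop :=
  Connected H ∧ ∀ x ∈ V(H), degree H x = 2

/-- A cacti-graph: no isolated vertices, no leaves and no cycle components. -/
def IsCactiGraph (G : Graph α β) : Prop :=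
  (∀ x ∈ V(G), degree G x ≠ 0) ∧ (∀ x ∈ V(G), degree G x ≠ 1) ∧
    ∀ H, IsComponent H G → ¬ IsCycle H

/-- `Δ G = |E(G)| - |V(G)|` (for a finite graph). -/
noncomputable def excess (G : Graph α β) : ℤ :=
  (E(G).ncard : ℤ) - (V(G).ncard : ℤ)

/-- The set of vertices incident to an edge in `X`. -/
def ends (G : Graph α β) (X : Set β) : Set α := {x | ∃ e ∈ X, G.Inc e x}

/-- The subgraph `G⟨X⟩` of `G` induced by a set `X` of edges: its edges are those in `X`, and its
vertices are the ends of these edges. -/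
def edgeSubgraph (G : Graph α β) (X : Set β) : Graph α β where
  vertexSet := ends G X
  IsLink e x y := e ∈ X ∧ G.IsLink e x y
  edgeSet := E(G) ∩ X
  isLink_symm _ _ := ⟨fun _ _ h ↦ ⟨h.1, h.2.symm⟩⟩
  eq_or_eq_of_isLink_of_isLink _ _ _ _ _ h h' := h.2.left_eq_or_eq h'.2
  edge_mem_iff_exists_isLink e :=
    ⟨fun h ↦ by
      obtain ⟨x, y, hxy⟩ := Graph.exists_isLink_of_mem_edgeSet h.1
      exact ⟨x, y, h.2, hxy⟩, fun ⟨_, _, h⟩ ↦ ⟨h.2.edge_mem, h.1⟩⟩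
  left_mem_of_isLink e _ _ h := ⟨e, h.1, h.2.inc_left⟩

/-- The family `𝒞ₖ(G)`: sets `C` of edges such that `Δ (G⟨C⟩) = k` and `G⟨C⟩` is a
cacti-graph. -/
def IsKCircuit (G : Graph α β) (k : ℕ) (C : Set β) : Prop :=
  C ⊆ E(G) ∧ excess (edgeSubgraph G C) = k ∧ IsCactiGraph (edgeSubgraph G C)

/-! ### The sets in `𝒞ₖ(G)` are the circuits of a matroid -/

lemma edgeSubgraph_inc {G : Graph α β} {X : Set β} {e : β} {x : α} :
    (edgeSubgraph G X).Inc e x ↔ e ∈ X ∧ G.Inc e x :=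
  ⟨fun ⟨y, h⟩ ↦ ⟨h.1, y, h.2⟩, fun ⟨h, y, h'⟩ ↦ ⟨y, h, h'⟩⟩

lemma ends_mono {G : Graph α β} {X Y : Set β} (h : X ⊆ Y) : ends G X ⊆ ends G Y :=
  fun _ ⟨e, he, hx⟩ ↦ ⟨e, h he, hx⟩

lemma ends_union (G : Graph α β) (X Y : Set β) : ends G (X ∪ Y) = ends G X ∪ ends G Y := by
  ext x
  simp only [ends, Set.mem_ofPred_eq, Set.mem_union]
  grind

lemma ends_finite (G : Graph α β) {X : Set β} (hX : X.Finite) : (ends G X).Finite := by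
  have : ends G X = ⋃ e ∈ X, {x | G.Inc e x} := by ext x; simp [ends]
  rw [this]
  refine hX.biUnion fun e _ ↦ ?_
  by_cases he : e ∈ E(G)
  · obtain ⟨x, y, h⟩ := Graph.exists_isLink_of_mem_edgeSet he
    exact ((Set.finite_singleton y).insert x).subset fun z hz ↦ by
      simpa using hz.eq_or_eq_of_isLink h
  · convert Set.finite_empty
    ext x
    simpa using fun h : G.Inc e x ↦ he h.edge_mem

lemma excess_edgeSubgraph {G : Graph α β} {X : Set β} (hX : X ⊆ E(G)) :
    excess (edgeSubgraph G X) = (X.ncard : ℤ) - ((ends G X).ncard : ℤ) := by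
  have : E(edgeSubgraph G X) = X := Set.inter_eq_right.2 hX
  rw [excess, this]
  rfl

/-- The contribution of the edge `e` to the sum of the degrees of the vertices in `W`. -/
lemma sum_ends [DecidableEq α] {G : Graph α β} {e : β} {x y : α} (h : G.IsLink e x y)
    (W : Finset α) [DecidablePred fun z ↦ G.Inc e z] [DecidablePred fun z ↦ G.IsLoopAt e z] :
    (W.filter fun z ↦ G.Inc e z).card + (W.filter fun z ↦ G.IsLoopAt e z).card =
      (if x ∈ W then 1 else 0) + (if y ∈ W then 1 else 0) := by
  have hinc : ∀ z, G.Inc e z ↔ z = x ∨ z = y := fun z ↦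
    ⟨fun hz ↦ hz.eq_or_eq_of_isLink h, by rintro (rfl | rfl); exacts [h.inc_left, h.inc_right]⟩
  by_cases hxy : x = y
  · subst hxy
    have hl : ∀ z, G.IsLoopAt e z ↔ z = x := fun z ↦
      ⟨fun hz ↦ by simpa using (hinc z).1 hz.inc, by rintro rfl; exact h⟩
    simp [hinc, hl, Finset.filter_eq']
    split_ifs <;> simp
  · have hl : ∀ z, ¬ G.IsLoopAt e z := fun z hz ↦ by
      have h1 := hz.eq_of_inc h.inc_left
      have h2 := hz.eq_of_inc h.inc_right
      exact hxy (h1.symm.trans h2)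
    simp only [hinc, hl, Finset.filter_or, Finset.filter_eq', Finset.filter_false]
    rw [Finset.card_union_of_disjoint]
    · split_ifs <;> simp
    · split_ifs <;> simp [hxy]

/-- Double counting of the incidences between a finite set `F` of edges and a finite set `W` of
vertices of which every incident edge lies in `F`. -/
lemma degree_count {G : Graph α β} {W : Set α} {F : Set β} (hW : W.Finite) (hF : F.Finite)
    (hFE : F ⊆ E(G)) (hWF : ∀ x ∈ W, G.incidenceSet x ⊆ F) (hdeg : ∀ x ∈ W, 2 ≤ degree G x) :
    W.ncard ≤ F.ncard ∧ (W.ncard = F.ncard →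
      (∀ x ∈ W, degree G x = 2) ∧ ∀ e ∈ F, ∀ x, G.Inc e x → x ∈ W) := by
  classical
  lift W to Finset α using hW
  lift F to Finset β using hF
  simp only [Finset.mem_coe] at *
  set d : α → ℕ := fun x ↦
    (F.filter fun e ↦ G.Inc e x).card + (F.filter fun e ↦ G.IsLoopAt e x).card with hd
  set c : β → ℕ := fun e ↦
    (W.filter fun x ↦ G.Inc e x).card + (W.filter fun x ↦ G.IsLoopAt e x).card with hc
  have hdd : ∀ x ∈ W, degree G x = d x := by
    intro x hx
    have h1 : G.incidenceSet x = (F.filter fun e ↦ G.Inc e x : Finset β) := by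
      ext e
      simpa using fun he : G.Inc e x ↦ Finset.mem_coe.1 (hWF x hx he)
    have h2 : G.loopSet x = (F.filter fun e ↦ G.IsLoopAt e x : Finset β) := by
      ext e
      simpa using fun he : G.IsLoopAt e x ↦ Finset.mem_coe.1 (hWF x hx he.inc)
    rw [degree, h1, h2, Set.encard_coe_eq_coe_finsetCard, Set.encard_coe_eq_coe_finsetCard, hd]
    push_cast
    rfl
  have hsum : ∑ x ∈ W, d x = ∑ e ∈ F, c e := by
    simp only [hd, hc, Finset.sum_add_distrib, Finset.card_filter]
    rw [Finset.sum_comm, Finset.sum_comm (s := W)]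
  have hd2 : ∀ x ∈ W, 2 ≤ d x := fun x hx ↦ by
    have := hdeg x hx
    rw [hdd x hx] at this
    exact_mod_cast this
  have hc' : ∀ e ∈ F, c e ≤ 2 ∧ (c e = 2 → ∀ x, G.Inc e x → x ∈ W) := by
    intro e he
    obtain ⟨x, y, h⟩ := Graph.exists_isLink_of_mem_edgeSet (hFE he)
    have := sum_ends h W
    simp only [hc, this]
    refine ⟨by split_ifs <;> simp, fun h2 z hz ↦ ?_⟩
    rcases hz.eq_or_eq_of_isLink h with rfl | rfl <;> by_contra hzW <;> simp [hzW] at h2 <;>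
      split_ifs at h2 <;> simp at h2
  have h1 : ∑ x ∈ W, 2 ≤ ∑ x ∈ W, d x := Finset.sum_le_sum hd2
  have h2 : ∑ e ∈ F, c e ≤ ∑ e ∈ F, 2 := Finset.sum_le_sum fun e he ↦ (hc' e he).1
  have h1' := h1
  have h2' := h2
  simp only [Finset.sum_const, smul_eq_mul] at h1' h2'
  simp only [Set.ncard_coe_finset]
  refine ⟨by omega, fun heq ↦ ⟨fun x hx ↦ ?_, fun e he ↦ ?_⟩⟩
  · have := (Finset.sum_eq_sum_iff_of_le hd2).1 (by simp; omega) x hx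
    rw [hdd x hx, ← this]
    rfl
  · exact (hc' e he).2 ((Finset.sum_eq_sum_iff_of_le fun e he ↦ (hc' e he).1).1
      (by simp; omega) e he)

lemma closed_degree {H G : Graph α β} (h : H ≤c G) {x : α} (hx : x ∈ V(H)) :
    degree H x = degree G x := by
  have h1 : H.incidenceSet x = G.incidenceSet x := by
    ext e
    exact Graph.IsClosedSubgraph.inc_congr hx h
  have h2 : H.loopSet x = G.loopSet x := by
    ext e
    exact Graph.IsClosedSubgraph.isLink_congr hx h
  rw [degree, degree, h1, h2]

/-- A set of edges with `|Y| ≥ |V(G⟨Y⟩)| + k` that is minimal with this property is in `𝒞ₖ(G)`. -/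
lemma isKCircuit_of_minimal {G : Graph α β} (hE : E(G).Finite) {k : ℕ} (hk : 1 ≤ k) {Y : Set β}
    (hYE : Y ⊆ E(G)) (hY : (ends G Y).ncard + k ≤ Y.ncard)
    (hmin : ∀ Z ⊂ Y, Z.ncard < (ends G Z).ncard + k) : IsKCircuit G k Y := by
  have hfin := hE.subset hYE
  have hdel : ∀ e ∈ Y, Y.ncard ≤ (ends G (Y \ {e})).ncard + k := fun e he ↦ by
    have h1 := hmin (Y \ {e}) (Set.sdiff_singleton_ssubset.2 he)
    have h2 := Set.ncard_sdiff_singleton_add_one he hfin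
    omega
  have hne : Y.Nonempty := by
    rw [Set.nonempty_iff_ne_empty]
    rintro rfl
    simp at hY
    omega
  refine ⟨hYE, ?_, fun x hx h0 ↦ ?_, fun x hx h1 ↦ ?_, fun H hH hcyc ↦ ?_⟩
  · obtain ⟨e, he⟩ := hne
    have h1 := hdel e he
    have h2 := Set.ncard_le_ncard (ends_mono (G := G) (Set.sdiff_subset (s := Y) (t := {e})))
      (ends_finite G hfin)
    rw [excess_edgeSubgraph hYE]
    omega
  · obtain ⟨e, he, hex⟩ := hx
    simp only [degree, add_eq_zero, Set.encard_eq_zero] at h0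
    exact (Set.eq_empty_iff_forall_notMem.1 h0.1) e (edgeSubgraph_inc.2 ⟨he, hex⟩)
  · obtain ⟨e, he, hex⟩ := hx
    have hmem : e ∈ (edgeSubgraph G Y).incidenceSet x := edgeSubgraph_inc.2 ⟨he, hex⟩
    have hle : ((edgeSubgraph G Y).incidenceSet x).encard ≤ 1 := by
      rw [← h1, degree]
      exact le_self_add
    have huniq := Set.encard_le_one_iff.1 hle
    have hsub : ends G (Y \ {e}) ⊆ ends G Y \ {x} := by
      rintro y ⟨f, hf, hfy⟩
      refine ⟨⟨f, hf.1, hfy⟩, ?_⟩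
      rintro rfl
      exact hf.2 (huniq f e (edgeSubgraph_inc.2 ⟨hf.1, hfy⟩) hmem)
    have h2 := Set.ncard_le_ncard hsub ((ends_finite G hfin).sdiff)
    have h3 := Set.ncard_sdiff_singleton_add_one (s := ends G Y) ⟨e, he, hex⟩ (ends_finite G hfin)
    have h4 := hdel e he
    omega
  · obtain ⟨hcl, ⟨x, hx⟩, -⟩ := hH
    have hEH : E(H) ⊆ Y := fun e he ↦ (hcl.le.edgeSet_mono he).2
    have hVH : V(H) ⊆ ends G Y := hcl.le.vertexSet_mono
    have hcard : E(H).ncard ≤ V(H).ncard := by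
      -- every edge of `H` has two ends in `H`, and every vertex of `H` has degree two
      classical
      have hVfin := (ends_finite G hfin).subset hVH
      have hEfin := hfin.subset hEH
      obtain ⟨W, hW⟩ : ∃ W : Finset α, (W : Set α) = V(H) := ⟨hVfin.toFinset, by simp⟩
      obtain ⟨F, hF⟩ : ∃ F : Finset β, (F : Set β) = E(H) := ⟨hEfin.toFinset, by simp⟩
      rw [← hW, ← hF, Set.ncard_coe_finset, Set.ncard_coe_finset]
      have hsum : ∑ x ∈ W, ((F.filter fun e ↦ H.Inc e x).card +
            (F.filter fun e ↦ H.IsLoopAt e x).card) =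
          ∑ e ∈ F, ((W.filter fun x ↦ H.Inc e x).card +
            (W.filter fun x ↦ H.IsLoopAt e x).card) := by
        simp only [Finset.sum_add_distrib, Finset.card_filter]
        rw [Finset.sum_comm, Finset.sum_comm (s := W)]
      have hl : ∀ x ∈ W, ((F.filter fun e ↦ H.Inc e x).card +
          (F.filter fun e ↦ H.IsLoopAt e x).card) = 2 := by
        intro x hx
        have h2 := hcyc.2 x (hW ▸ Finset.mem_coe.2 hx)
        have h1 : H.incidenceSet x = (F.filter fun e ↦ H.Inc e x : Finset β) := by
          ext e
          have : H.Inc e x → e ∈ F := fun he ↦ Finset.mem_coe.1 (hF ▸ he.edge_mem)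
          simpa using this
        have h3 : H.loopSet x = (F.filter fun e ↦ H.IsLoopAt e x : Finset β) := by
          ext e
          have : H.IsLoopAt e x → e ∈ F := fun he ↦ Finset.mem_coe.1 (hF ▸ he.edge_mem)
          simpa using this
        rw [degree, h1, h3, Set.encard_coe_eq_coe_finsetCard,
          Set.encard_coe_eq_coe_finsetCard] at h2
        exact_mod_cast h2
      have hr : ∀ e ∈ F, ((W.filter fun x ↦ H.Inc e x).card +
          (W.filter fun x ↦ H.IsLoopAt e x).card) = 2 := by
        intro e he
        obtain ⟨y, z, h⟩ := Graph.exists_isLink_of_mem_edgeSet (hF ▸ Finset.mem_coe.2 he)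
        have hy : y ∈ W := Finset.mem_coe.1 (hW ▸ h.left_mem)
        have hz : z ∈ W := Finset.mem_coe.1 (hW ▸ h.right_mem)
        rw [sum_ends h W, if_pos hy, if_pos hz]
      rw [Finset.sum_congr rfl hl, Finset.sum_congr rfl hr] at hsum
      simp at hsum
      omega
    have hEne : E(H).Nonempty := by
      obtain ⟨e, he, hex⟩ := hVH hx
      exact ⟨e, hcl.closed (edgeSubgraph_inc.2 ⟨he, hex⟩) hx⟩
    have hsub : ends G (Y \ E(H)) ⊆ ends G Y \ V(H) := by
      rintro y ⟨f, hf, hfy⟩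
      exact ⟨⟨f, hf.1, hfy⟩, fun hy ↦ hf.2 (hcl.closed (edgeSubgraph_inc.2 ⟨hf.1, hfy⟩) hy)⟩
    have h1 := hmin (Y \ E(H)) (by
      refine Set.sdiff_subset.ssubset_of_ne fun h ↦ ?_
      obtain ⟨e, he⟩ := hEne
      have he' : e ∈ Y \ E(H) := by rw [h]; exact hEH he
      exact he'.2 he)
    have h2 := Set.ncard_le_ncard hsub ((ends_finite G hfin).sdiff)
    have h3 := Set.ncard_sdiff_add_ncard_of_subset hVH (ends_finite G hfin)
    have h4 := Set.ncard_sdiff_add_ncard_of_subset hEH hfin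
    omega

/-- The component of a vertex. -/
lemma exists_component {G : Graph α β} {x : α} (hx : x ∈ V(G)) :
    ∃ H, IsComponent H G ∧ V(H) = {y | Relation.ReflTransGen G.Adj x y} := by
  have hsub : {y | Relation.ReflTransGen G.Adj x y} ⊆ V(G) := by
    intro y hy
    rcases Relation.ReflTransGen.cases_tail hy with rfl | ⟨z, -, h⟩
    exacts [hx, h.right_mem]
  have hstep : ∀ {y z}, (G.induce {y | Relation.ReflTransGen G.Adj x y}).Adj y z ↔
      Relation.ReflTransGen G.Adj x y ∧ G.Adj y z := by
    intro y z
    exact ⟨fun ⟨e, h⟩ ↦ ⟨h.2.1, e, h.1⟩, fun ⟨h, e, h'⟩ ↦ ⟨e, h', h, h.tail ⟨e, h'⟩⟩⟩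
  refine ⟨G.induce {y | Relation.ReflTransGen G.Adj x y}, ⟨?_, ⟨x, .refl⟩, ?_⟩, rfl⟩
  · refine Graph.IsClosedSubgraph.mk' (Graph.induce_le hsub) ?_
    rintro e y ⟨z, h⟩ hy
    exact ⟨y, z, h, hy, Relation.ReflTransGen.tail hy ⟨e, h⟩⟩
  · have key : ∀ y, Relation.ReflTransGen G.Adj x y →
        Relation.ReflTransGen (G.induce {y | Relation.ReflTransGen G.Adj x y}).Adj x y := by
      intro y hy
      induction hy with
      | refl => exact .refl
      | tail h1 h2 ih => exact ih.tail (hstep.2 ⟨h1, h2⟩)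
    intro y hy z hz
    refine Relation.ReflTransGen.trans ?_ (key z hz)
    exact Relation.ReflTransGen.stdSymm.symm _ _ (key y hy)

/-- Proper subsets of a member of `𝒞ₖ(G)` satisfy the strict count. -/
lemma IsKCircuit.count_lt {G : Graph α β} (hE : E(G).Finite) {k : ℕ} {C D : Set β}
    (hC : IsKCircuit G k C) (hD : D ⊂ C) : D.ncard < (ends G D).ncard + k := by
  obtain ⟨hCE, hex, hdeg0, hdeg1, hcomp⟩ := hC
  have hfin := hE.subset hCE
  rw [excess_edgeSubgraph hCE] at hex
  have hends := ends_mono (G := G) hD.subset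
  set W := ends G C \ ends G D
  have hcard1 : W.ncard + (ends G D).ncard = (ends G C).ncard := Set.ncard_sdiff_add_ncard_of_subset hends (ends_finite G hfin)
  have hcard2 := Set.ncard_sdiff_add_ncard_of_subset hD.subset hfin
  have hWF : ∀ x ∈ W, (edgeSubgraph G C).incidenceSet x ⊆ C \ D := by
    intro x hx e he
    have := edgeSubgraph_inc.1 he
    exact ⟨this.1, fun heD ↦ hx.2 ⟨e, heD, this.2⟩⟩
  have hne : (C \ D).Nonempty := Set.nonempty_of_ssubset hD
  have hpos : 0 < (C \ D).ncard := (Set.ncard_pos (hfin.sdiff)).2 hne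
  obtain ⟨hle, heq⟩ := degree_count (G := edgeSubgraph G C) (W := W) (F := C \ D)
    ((ends_finite G hfin).sdiff) hfin.sdiff (fun e he ↦ ⟨hCE he.1, he.1⟩) hWF (by
      intro x hx
      have h0 := hdeg0 x hx.1
      have h1 := hdeg1 x hx.1
      by_contra h
      have h' := Order.le_of_lt_add_one
        (show degree (edgeSubgraph G C) x < 1 + 1 by rw [one_add_one_eq_two]; exact not_le.1 h)
      have h'' := lt_of_le_of_ne h' h1
      rw [Order.lt_one_iff] at h''
      exact h0 h'')
  by_contra hcon
  obtain ⟨hd2, hin⟩ := heq (by omega)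
  obtain ⟨e, he⟩ := hne
  obtain ⟨x, y, hxy⟩ := Graph.exists_isLink_of_mem_edgeSet (hCE he.1)
  have hxW : x ∈ W := hin e he x (edgeSubgraph_inc.2 ⟨he.1, hxy.inc_left⟩)
  obtain ⟨H, hH, hHV⟩ := exists_component (G := edgeSubgraph G C) (x := x) hxW.1
  have hVW : ∀ z, Relation.ReflTransGen (edgeSubgraph G C).Adj x z → z ∈ W := by
    intro z hz
    induction hz with
    | refl => exact hxW
    | tail _ h ih =>
      obtain ⟨f, hf⟩ := h
      exact hin f (hWF _ ih hf.inc_left) _ hf.inc_right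
  refine hcomp H hH ⟨hH.2, fun z hz ↦ ?_⟩
  rw [closed_degree hH.1 hz]
  exact hd2 z (hVW z (by rw [hHV] at hz; exact hz))

lemma IsKCircuit.count_le {G : Graph α β} {k : ℕ} {C : Set β}
    (hC : IsKCircuit G k C) : (ends G C).ncard + k ≤ C.ncard := by
  have := hC.2.1
  rw [excess_edgeSubgraph hC.1] at this
  omega

/-- A set of edges contains no member of `𝒞ₖ(G)` exactly if `|Y| < |V(G⟨Y⟩)| + k` for all its
subsets `Y`. -/
lemma forall_not_isKCircuit_iff {G : Graph α β} (hE : E(G).Finite) {k : ℕ} (hk : 1 ≤ k)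
    {I : Set β} (hI : I ⊆ E(G)) :
    (∀ C ⊆ I, ¬ IsKCircuit G k C) ↔ ∀ Y ⊆ I, Y.ncard < (ends G Y).ncard + k := by
  refine ⟨fun h Y hY ↦ ?_, fun h C hC hCk ↦ (h C hC).not_ge hCk.count_le⟩
  by_contra hcon
  have hfin : {Z | Z ⊆ Y ∧ (ends G Z).ncard + k ≤ Z.ncard}.Finite :=
    (hE.subset (hY.trans hI)).finite_subsets.subset fun Z hZ ↦ hZ.1
  obtain ⟨Z, hZ⟩ := hfin.exists_minimal ⟨Y, subset_rfl, not_lt.1 hcon⟩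
  refine h Z (hZ.prop.1.trans hY) (isKCircuit_of_minimal hE hk (hZ.prop.1.trans (hY.trans hI))
    hZ.prop.2 fun T hT ↦ ?_)
  by_contra hT'
  exact hT.not_subset (hZ.le_of_le ⟨hT.subset.trans hZ.prop.1, not_lt.1 hT'⟩ hT.subset)

lemma count_aug {G : Graph α β} (hE : E(G).Finite) {k : ℕ} {I J : Set β}
    (hIE : I ⊆ E(G)) (hJE : J ⊆ E(G)) (hI : ∀ Y ⊆ I, Y.ncard < (ends G Y).ncard + k)
    (hJ : ∀ Y ⊆ J, Y.ncard < (ends G Y).ncard + k) (hIJ : I.ncard < J.ncard) :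
    ∃ e ∈ J, e ∉ I ∧ ∀ Y ⊆ insert e I, Y.ncard < (ends G Y).ncard + k := by
  by_contra! hcon
  have hIf := hE.subset hIE
  have hJf := hE.subset hJE
  have hfe : ∀ {X}, X ⊆ I → (ends G X).Finite := fun h ↦ ends_finite G (hIf.subset h)
  -- every edge in `J \ I` is spanned by a tight subset of `I`
  have htight : ∀ e ∈ J \ I, ∃ X ⊆ I, X.ncard + 1 = (ends G X).ncard + k ∧
      ends G {e} ⊆ ends G X := by
    rintro e ⟨heJ, heI⟩
    obtain ⟨Y, hYI, hY⟩ := hcon e heJ heI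
    have hYf : Y.Finite := (hIf.insert e).subset hYI
    have heY : e ∈ Y := by
      by_contra heY
      exact (hI Y ((Set.subset_insert_iff_of_notMem heY).1 hYI)).not_ge hY
    have hXI : Y \ {e} ⊆ I := by
      rintro f ⟨hf, hfe⟩
      exact (hYI hf).resolve_left hfe
    have h1 := Set.ncard_sdiff_singleton_add_one heY hYf
    have h2 := hI _ hXI
    have h3 := ends_mono (G := G) (Set.sdiff_subset (s := Y) (t := {e}))
    have h4 := Set.ncard_le_ncard h3 (ends_finite G hYf)
    refine ⟨Y \ {e}, hXI, by omega, ?_⟩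
    rw [Set.eq_of_subset_of_ncard_le h3 (by omega) (ends_finite G hYf)]
    exact ends_mono (by simpa using heY)
  obtain ⟨e₀, he₀⟩ : (J \ I).Nonempty := by
    rw [Set.nonempty_iff_ne_empty, Ne, Set.sdiff_eq_empty]
    exact fun h ↦ (Set.ncard_le_ncard h hIf).not_gt hIJ
  obtain ⟨X₀, hX₀I, hX₀, -⟩ := htight e₀ he₀
  have hfin : {X | X ⊆ I ∧ X.ncard + 1 = (ends G X).ncard + k}.Finite :=
    hIf.finite_subsets.subset fun X hX ↦ hX.1
  obtain ⟨T, hT⟩ := hfin.exists_maximal ⟨X₀, hX₀I, hX₀⟩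
  obtain ⟨hTI, hTt⟩ := hT.prop
  have hmax : ∀ X ⊆ I, X.ncard + 1 = (ends G X).ncard + k → X ⊆ T := by
    intro X hX hXt
    have hU : T ∪ X ⊆ I := Set.union_subset hTI hX
    have h1 := Set.ncard_union_add_ncard_inter T X (hIf.subset hTI) (hIf.subset hX)
    have h2 := Set.ncard_union_add_ncard_inter (ends G T) (ends G X) (hfe hTI) (hfe hX)
    rw [← ends_union] at h2
    have h3 : ends G (T ∩ X) ⊆ ends G T ∩ ends G X :=
      Set.subset_inter (ends_mono Set.inter_subset_left) (ends_mono Set.inter_subset_right)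
    have h4 := Set.ncard_le_ncard h3 ((hfe hTI).inter_of_left _)
    have h5 := hI (T ∩ X) (Set.inter_subset_left.trans hTI)
    have h6 := hI _ hU
    have := hT.le_of_ge ⟨hU, by omega⟩ Set.subset_union_left
    exact Set.subset_union_right.trans this
  have hsub : ends G ((J ∩ T) ∪ (J \ I)) ⊆ ends G T := by
    rintro x ⟨e, he | he, hex⟩
    · exact ⟨e, he.2, hex⟩
    · obtain ⟨X, hXI, hXt, hXe⟩ := htight e he
      exact ends_mono (hmax X hXI hXt) (hXe ⟨e, rfl, hex⟩)
  have h1 := hJ ((J ∩ T) ∪ (J \ I)) (Set.union_subset Set.inter_subset_left Set.sdiff_subset)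
  have h2 := Set.ncard_le_ncard hsub (hfe hTI)
  have h3 : J ⊆ ((J ∩ T) ∪ (J \ I)) ∪ (I \ T) := by
    intro e he
    simp only [Set.mem_union, Set.mem_inter_iff, Set.mem_sdiff]
    tauto
  have h4 := Set.ncard_le_ncard h3
    (((hJf.inter_of_left _).union hJf.sdiff).union hIf.sdiff)
  have h5 := Set.ncard_union_le ((J ∩ T) ∪ (J \ I)) (I \ T)
  have h6 := Set.ncard_sdiff_add_ncard_of_subset hTI hIf
  omega

/-- The `k`-circular matroid `Mₖ(G)` of a graph `G` with finitely many edges, for `k ≥ 1`: a set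
of edges is independent if it contains no member of `𝒞ₖ(G)`. -/
noncomputable def kCircularMatroid (G : Graph α β) (hE : E(G).Finite) (k : ℕ) (hk : 1 ≤ k) :
    Matroid β :=
  (IndepMatroid.ofFinite hE (fun I ↦ I ⊆ E(G) ∧ ∀ C ⊆ I, ¬ IsKCircuit G k C)
    ⟨Set.empty_subset _, by
      rw [forall_not_isKCircuit_iff hE hk (Set.empty_subset _)]
      intro Y hY
      rw [Set.subset_empty_iff.1 hY, Set.ncard_empty]
      omega⟩
    (fun _ _ hJ hIJ ↦ ⟨hIJ.trans hJ.1, fun C hC ↦ hJ.2 C (hC.trans hIJ)⟩)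
    (fun I J hI hJ hIJ ↦ by
      obtain ⟨e, heJ, heI, h⟩ := count_aug hE hI.1 hJ.1
        ((forall_not_isKCircuit_iff hE hk hI.1).1 hI.2)
        ((forall_not_isKCircuit_iff hE hk hJ.1).1 hJ.2) hIJ
      have hsub : insert e I ⊆ E(G) := Set.insert_subset (hJ.1 heJ) hI.1
      exact ⟨e, heJ, heI, hsub, (forall_not_isKCircuit_iff hE hk hsub).2 h⟩)
    (fun _ hI ↦ hI.1)).matroid

lemma kCircularMatroid_ground (G : Graph α β) (hE : E(G).Finite) (k : ℕ) (hk : 1 ≤ k) :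
    (kCircularMatroid G hE k hk).E = E(G) := rfl

lemma kCircularMatroid_indep_iff (G : Graph α β) (hE : E(G).Finite) (k : ℕ) (hk : 1 ≤ k)
    (I : Set β) : (kCircularMatroid G hE k hk).Indep I ↔
      I ⊆ E(G) ∧ ∀ C ⊆ I, ¬ IsKCircuit G k C := Iff.rfl

/-- The circuits of `Mₖ(G)` are exactly the members of `𝒞ₖ(G)`. -/
theorem kCircularMatroid_isCircuit_iff (G : Graph α β) (hE : E(G).Finite) (k : ℕ) (hk : 1 ≤ k)
    (C : Set β) : (kCircularMatroid G hE k hk).IsCircuit C ↔ IsKCircuit G k C := by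
  rw [Matroid.isCircuit_iff_forall_ssubset, Matroid.dep_iff]
  simp only [kCircularMatroid_indep_iff, kCircularMatroid_ground]
  constructor
  · rintro ⟨⟨h1, hCE⟩, h2⟩
    have : ∃ D ⊆ C, IsKCircuit G k D := by
      by_contra! hcon
      exact h1 ⟨hCE, hcon⟩
    obtain ⟨D, hDC, hD⟩ := this
    rcases hDC.eq_or_ssubset with rfl | hss
    · exact hD
    · exact absurd hD ((h2 hss).2 D subset_rfl)
  · intro hC
    refine ⟨⟨fun h ↦ h.2 C subset_rfl hC, hC.1⟩, fun I hI ↦ ⟨hI.subset.trans hC.1, ?_⟩⟩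
    intro D hD hDk
    exact (hC.count_lt hE (hD.trans_ssubset hI)).not_ge hDk.count_le

/-! ### Non-separating cocircuits and small vertex stars -/

/-- A matroid is connected if it has no loops and no coloops and every two of its elements belong
to a common circuit. -/
def MatroidConnected (M : Matroid β) : Prop :=
  (∀ e ∈ M.E, ¬ M.IsLoop e) ∧ (∀ e ∈ M.E, ¬ M.IsColoop e) ∧
    ∀ e ∈ M.E, ∀ f ∈ M.E, ∃ C, M.IsCircuit C ∧ e ∈ C ∧ f ∈ C

/-- A non-separating cocircuit of a connected matroid `M` is a cocircuit `K` such that `M ＼ K` is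
connected. -/
def IsNonseparatingCocircuit (M : Matroid β) (K : Set β) : Prop :=
  MatroidConnected M ∧ M.IsCocircuit K ∧ MatroidConnected (M ＼ K)

/-- `S` is a vertex star of `G`: the set of all edges incident to some vertex of `G`. -/
def IsVertexStar (G : Graph α β) (S : Set β) : Prop :=
  ∃ x ∈ V(G), S = G.incidenceSet x

end KCircular

/-!
A basis of a cyclic set `F ≠ ∅` of `Mₖ(G)`, that is, of a union of circuits, has
`|V(G⟨F⟩)| + k - 1` elements. Hence, if `Mₖ(G)` splits into two cyclic parts `A` and `B`
without a circuit meeting both, then `G⟨A⟩` and `G⟨B⟩` have no common vertex: otherwise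
the union of a basis of `A` and a basis of `B` would be an independent set that is too large. A
connected graph cannot be split like this, and if all its degrees are at least two, then
`|V(G)| + k ≤ |E(G)|` makes a vertex or a coloop outside the union of the circuits impossible by
counting. So under these conditions `Mₖ(G)` is connected precisely if `|V(G)| + k ≤ |E(G)|`.

A cyclic set with the same vertices as `G` is spanning, so a cyclic set whose complement is a
cocircuit `K` misses a vertex `x`, and minimality of `K` makes it the star of `x`. Deleting the
star of `x` from `Mₖ(G)` gives `Mₖ(G - x)`, which is connected precisely if
`|V(G)| - 1 + k ≤ |E(G - x)|`. This says that the star has at most `ρₖ*(G)` elements, since the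
rank of `Mₖ(G)` is `|V(G)| + k - 1`.
-/

namespace KCircular

variable {α β : Type*}

section Matroid

variable {M : Matroid β}

lemma exists_isCircuit_union_ssubset {C₁ C₂ : Set β} (h₁ : M.IsCircuit C₁) (h₂ : M.IsCircuit C₂)
    (hne : (C₁ ∩ C₂).Nonempty) {e f : β} (he : e ∈ C₁ \ C₂) (hf : f ∈ C₂ \ C₁) :
    ∃ D₁ D₂, M.IsCircuit D₁ ∧ M.IsCircuit D₂ ∧ (D₁ ∩ D₂).Nonempty ∧ e ∈ D₁ ∧ f ∈ D₂ ∧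
      D₁ ∪ D₂ ⊂ C₁ ∪ C₂ := by
  obtain ⟨g, hg₁, hg₂⟩ := hne
  obtain ⟨C₃, hC₃, h₃, heC₃⟩ := h₁.strong_elimination h₂ hg₁ hg₂ he.1 he.2
  obtain ⟨C₄, hC₄, h₄, hfC₄⟩ := h₂.strong_elimination h₁ hg₂ hg₁ hf.1 hf.2
  rw [Set.union_comm C₂] at hC₄
  by_cases hmeet : (C₃ ∩ C₄).Nonempty
  · exact ⟨C₃, C₄, h₃, h₄, hmeet, heC₃, hfC₄,
      (Set.union_subset hC₃ hC₄).trans_ssubset (Set.sdiff_singleton_ssubset.2 (.inl hg₁))⟩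
  have hgC₃ : g ∉ C₃ := fun h ↦ (hC₃ h).2 rfl
  have hgC₄ : g ∉ C₄ := fun h ↦ (hC₄ h).2 rfl
  obtain ⟨y, hyC₃, hyC₁⟩ := Set.not_subset.1 fun h ↦
    hgC₃ (h₃.eq_of_subset_isCircuit h₁ h ▸ hg₁)
  obtain ⟨z, hzC₄, hzC₂⟩ := Set.not_subset.1 fun h ↦
    hgC₄ (h₄.eq_of_subset_isCircuit h₂ h ▸ hg₂)
  have hyC₄ : y ∉ C₄ := fun h ↦ hmeet ⟨y, hyC₃, h⟩
  refine ⟨C₁, C₄, h₁, h₄, ⟨z, (hC₄ hzC₄).1.resolve_right hzC₂, hzC₄⟩, he.1, hfC₄,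
    Set.union_subset Set.subset_union_left (hC₄.trans Set.sdiff_subset), fun h ↦ ?_⟩
  exact (h (hC₃ hyC₃).1).elim hyC₁ hyC₄

lemma exists_isCircuit_mem_mem [M.Finitary] {C₁ C₂ : Set β} (h₁ : M.IsCircuit C₁)
    (h₂ : M.IsCircuit C₂) (hne : (C₁ ∩ C₂).Nonempty) {e f : β} (he : e ∈ C₁) (hf : f ∈ C₂) :
    ∃ C, M.IsCircuit C ∧ e ∈ C ∧ f ∈ C := by
  induction hn : (C₁ ∪ C₂).ncard using Nat.strong_induction_on generalizing C₁ C₂ with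
  | _ n ih =>
    by_cases heC : e ∈ C₂
    · exact ⟨C₂, h₂, heC, hf⟩
    by_cases hfC : f ∈ C₁
    · exact ⟨C₁, h₁, he, hfC⟩
    obtain ⟨D₁, D₂, hD₁, hD₂, hD, heD, hfD, hlt⟩ :=
      exists_isCircuit_union_ssubset h₁ h₂ hne ⟨he, heC⟩ ⟨hf, hfC⟩
    exact ih _ (hn ▸ Set.ncard_lt_ncard hlt (h₁.finite.union h₂.finite)) hD₁ hD₂ hD heD hfD rfl

/-- A set of elements of a matroid is cyclic if it is a union of circuits. -/
def IsCyclicSet (M : Matroid β) (F : Set β) : Prop :=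
  ∀ e ∈ F, ∃ C ⊆ F, M.IsCircuit C ∧ e ∈ C

lemma IsCyclicSet.subset_ground {F : Set β} (hF : IsCyclicSet M F) : F ⊆ M.E := fun e he ↦ by
  obtain ⟨C, -, hC, heC⟩ := hF e he
  exact hC.subset_ground heC

lemma IsCyclicSet.not_indep {F : Set β} (hF : IsCyclicSet M F) (hne : F.Nonempty) :
    ¬ M.Indep F := fun h ↦ by
  obtain ⟨e, he⟩ := hne
  obtain ⟨C, hCF, hC, -⟩ := hF e he
  exact hC.not_indep (h.subset hCF)

lemma isCyclicSet_ground_sdiff_coloops (M : Matroid β) : IsCyclicSet M (M.E \ M.coloops) := by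
  rintro e ⟨heE, he⟩
  have hcirc : ¬ ∀ ⦃C⦄, M.IsCircuit C → e ∉ C :=
    mt (Matroid.isColoop_iff_forall_notMem_isCircuit heE).2 he
  push Not at hcirc
  obtain ⟨C, hC, heC⟩ := hcirc
  exact ⟨C, Set.subset_sdiff.2 ⟨hC.subset_ground, hC.disjoint_coloops⟩, hC, heC⟩

lemma MatroidConnected.isCyclicSet_ground (h : MatroidConnected M) : IsCyclicSet M M.E :=
  fun e he ↦ by
    obtain ⟨C, hC, heC, -⟩ := h.2.2 e he e he
    exact ⟨C, hC.subset_ground, hC, heC⟩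

lemma MatroidConnected.isCyclicSet_delete {K : Set β} (h : MatroidConnected (M ＼ K)) :
    IsCyclicSet M (M.E \ K) := fun e he ↦ by
  obtain ⟨C, hCE, hC, heC⟩ := h.isCyclicSet_ground e he
  exact ⟨C, hCE, hC.of_delete, heC⟩

lemma matroidConnected_of_forall [M.Loopless]
    (h : ∀ e ∈ M.E, ∀ f ∈ M.E, ∃ C, M.IsCircuit C ∧ e ∈ C ∧ f ∈ C) : MatroidConnected M := by
  refine ⟨fun e _ ↦ M.not_isLoop e, fun e heE he ↦ ?_, h⟩
  obtain ⟨C, hC, heC, -⟩ := h e heE e heE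
  exact (Matroid.isColoop_iff_forall_notMem_isCircuit heE).1 he hC heC

lemma IsCyclicSet.exists_separation [M.Finitary] (hM : IsCyclicSet M M.E) {e f : β} (he : e ∈ M.E)
    (hf : f ∈ M.E) (hef : ∀ C, M.IsCircuit C → e ∈ C → f ∉ C) :
    ∃ A B, A ∪ B = M.E ∧ e ∈ A ∧ f ∈ B ∧ Disjoint A B ∧ IsCyclicSet M A ∧ IsCyclicSet M B ∧
      ∀ C, M.IsCircuit C → C ⊆ A ∨ C ⊆ B := by
  set A := {g | ∃ C, M.IsCircuit C ∧ e ∈ C ∧ g ∈ C}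
  have hA : ∀ C, M.IsCircuit C → ∀ g ∈ C, g ∈ A → C ⊆ A := by
    rintro C hC g hg ⟨D, hD, heD, hgD⟩ x hx
    exact exists_isCircuit_mem_mem hD hC ⟨g, hgD, hg⟩ heD hx
  have hAB : ∀ C, M.IsCircuit C → C ⊆ A ∨ C ⊆ M.E \ A := fun C hC ↦ by
    by_contra! hcon
    obtain ⟨g, hg, hgA⟩ := Set.not_subset.1 hcon.2
    exact hcon.1 (hA C hC g hg (by_contra fun h ↦ hgA ⟨hC.subset_ground hg, h⟩))
  have heA : e ∈ A := by
    obtain ⟨C, -, hC, heC⟩ := hM e he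
    exact ⟨C, hC, heC, heC⟩
  have hAE : A ⊆ M.E := fun g ⟨C, hC, _, hg⟩ ↦ hC.subset_ground hg
  refine ⟨A, M.E \ A, Set.union_sdiff_cancel hAE, heA,
    ⟨hf, fun ⟨C, hC, heC, hfC⟩ ↦ hef C hC heC hfC⟩, Set.disjoint_sdiff_right, ?_, ?_, hAB⟩
  · rintro g ⟨C, hC, heC, hgC⟩
    exact ⟨C, hA C hC e heC heA, hC, hgC⟩
  · rintro g ⟨hgE, hgA⟩
    obtain ⟨C, -, hC, hgC⟩ := hM g hgE
    exact ⟨C, (hAB C hC).resolve_left fun h ↦ hgA (h hgC), hC, hgC⟩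

lemma indep_union_of_forall_isCircuit {I J : Set β} (hI : M.Indep I) (hJ : M.Indep J)
    (h : ∀ C ⊆ I ∪ J, M.IsCircuit C → C ⊆ I ∨ C ⊆ J) : M.Indep (I ∪ J) := by
  rw [Matroid.indep_iff_forall_subset_not_isCircuit
    (Set.union_subset hI.subset_ground hJ.subset_ground)]
  intro C hCIJ hC
  rcases h C hCIJ hC with hCI | hCJ
  exacts [hC.not_indep (hI.subset hCI), hC.not_indep (hJ.subset hCJ)]

lemma not_indep_ground_of_encard_le_eRank_dual {S : Set β} (hne : S.Nonempty)
    (hS : S.encard ≤ M✶.eRank) : ¬ M.Indep M.E := fun h ↦ by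
  rw [← (Matroid.ground_indep_iff_isBase.1 h).encard_compl_eq, sdiff_self, Set.bot_eq_empty,
    Set.encard_empty, nonpos_iff_eq_zero, Set.encard_eq_zero] at hS
  exact hne.ne_empty hS

lemma encard_le_eRank_dual_iff [M.Finite] {S : Set β} (hS : S ⊆ M.E) :
    S.encard ≤ M✶.eRank ↔ M.eRank ≤ (M.E \ S).encard := by
  have hr : M.eRank ≠ ⊤ := M.eRank_ne_top_iff.2 inferInstance
  have hS' : S.encard ≠ ⊤ := Set.encard_ne_top_iff.2 (M.ground_finite.subset hS)
  rw [← ENat.add_le_add_iff_left hr, M.eRank_add_eRank_dual,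
    ← Set.encard_sdiff_add_encard_of_subset hS, ENat.add_le_add_iff_right hS']

end Matroid

section Graph

variable {G H : Graph α β}

lemma Connected.subset_of_closed (hG : Connected G) {W : Set α} {x : α} (hx : x ∈ V(G))
    (hxW : x ∈ W) (hW : ∀ y z, G.Adj y z → y ∈ W → z ∈ W) : V(G) ⊆ W := by
  intro y hy
  induction hG.2 x hx y hy with
  | refl => exact hxW
  | tail _ hadj ih => exact hW _ _ hadj (ih hadj.left_mem)

lemma Connected.exists_isLink_ne (hG : Connected G) (hnt : V(G).Nontrivial) {x : α}
    (hx : x ∈ V(G)) : ∃ e y, G.IsLink e x y ∧ y ≠ x := by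
  by_contra! hloop
  refine hnt.not_subset_singleton (x := x) (hG.subset_of_closed hx rfl ?_)
  rintro _ y ⟨e, he⟩ rfl
  exact hloop e y he

lemma ends_subset_vertexSet (X : Set β) : ends G X ⊆ V(G) :=
  fun _ ⟨_, _, hx⟩ ↦ hx.vertex_mem

lemma ends_nonempty {X : Set β} (hX : X ⊆ E(G)) (hne : X.Nonempty) : (ends G X).Nonempty := by
  obtain ⟨e, he⟩ := hne
  obtain ⟨x, y, hxy⟩ := Graph.exists_isLink_of_mem_edgeSet (hX he)
  exact ⟨x, e, he, hxy.inc_left⟩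

lemma nonempty_of_ends_nonempty {X : Set β} (h : (ends G X).Nonempty) : X.Nonempty := by
  obtain ⟨_, e, he, -⟩ := h
  exact ⟨e, he⟩

lemma Connected.not_disjoint_ends (hG : Connected G) {A B : Set β} (hAB : A ∪ B = E(G))
    (hA : A.Nonempty) (hB : B.Nonempty) : ¬ Disjoint (ends G A) (ends G B) := by
  intro hdisj
  obtain ⟨x, hxA⟩ := ends_nonempty (hAB ▸ Set.subset_union_left) hA
  obtain ⟨y, hyB⟩ := ends_nonempty (hAB ▸ Set.subset_union_right) hB
  have hclosed : ∀ v w, G.Adj v w → v ∈ ends G A → w ∈ ends G A := by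
    rintro v w ⟨e, he⟩ hv
    rcases hAB.ge he.edge_mem with heA | heB
    · exact ⟨e, heA, he.inc_right⟩
    · exact (hdisj.notMem_of_mem_left hv ⟨e, heB, he.inc_left⟩).elim
  exact hdisj.notMem_of_mem_right hyB
    (hG.subset_of_closed (ends_subset_vertexSet A hxA) hxA hclosed (ends_subset_vertexSet B hyB))

lemma degree_ne_zero_iff {x : α} : degree G x ≠ 0 ↔ ∃ e, G.Inc e x := by
  refine ⟨fun h ↦ ?_, fun ⟨e, he⟩ h ↦ ?_⟩
  · by_contra! hx
    refine h (add_eq_zero.2 ⟨?_, ?_⟩) <;> rw [Set.encard_eq_zero, Set.eq_empty_iff_forall_notMem]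
    exacts [hx, fun e (he : G.IsLoopAt e x) ↦ hx e he.inc]
  · exact Set.eq_empty_iff_forall_notMem.1 (Set.encard_eq_zero.1 (add_eq_zero.1 h).1) e he

lemma two_le_degree_of_inc_of_inc {e f : β} {x : α} (he : G.Inc e x) (hf : G.Inc f x)
    (hef : e ≠ f) : 2 ≤ degree G x := by
  have hpair : {e, f} ⊆ G.incidenceSet x := Set.insert_subset he (Set.singleton_subset_iff.2 hf)
  exact (Set.encard_pair hef).ge.trans ((Set.encard_le_encard hpair).trans le_self_add)

lemma degree_mono (hHG : H ≤ G) (x : α) : degree H x ≤ degree G x :=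
  add_le_add (Set.encard_le_encard fun _ (he : H.Inc _ _) ↦ he.mono hHG)
    (Set.encard_le_encard fun _ (he : H.IsLoopAt _ _) ↦ he.mono hHG)

lemma ends_edgeSet (hdeg : ∀ x ∈ V(G), degree G x ≠ 0) : ends G E(G) = V(G) := by
  refine (ends_subset_vertexSet _).antisymm fun x hx ↦ ?_
  obtain ⟨e, he⟩ := degree_ne_zero_iff.1 (hdeg x hx)
  exact ⟨e, he.edge_mem, he⟩

lemma Connected.two_le_degree (hG : Connected G) (hG' : ∀ z ∈ V(G), Connected (G.deleteVerts {z}))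
    (hcard : 3 ≤ V(G).encard) {x : α} (hx : x ∈ V(G)) : 2 ≤ degree G x := by
  have hnt : V(G).Nontrivial := Set.one_lt_encard_iff_nontrivial.1
    (lt_of_lt_of_le (by norm_num) hcard)
  obtain ⟨e, z, he, hzx⟩ := hG.exists_isLink_ne hnt hx
  have hnt' : V(G.deleteVerts {z}).Nontrivial := by
    rw [Graph.vertexSet_deleteVerts, ← Set.one_lt_encard_iff_nontrivial]
    have hz := Set.encard_sdiff_singleton_add_one he.right_mem
    rw [← hz, show (3 : ℕ∞) = 2 + 1 by norm_num, ENat.add_le_add_iff_right (by simp)] at hcard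
    exact lt_of_lt_of_le (by norm_num) hcard
  obtain ⟨f, y, hf, hyx⟩ := (hG' z he.right_mem).exists_isLink_ne hnt' (x := x)
    (by simpa using ⟨hx, hzx.symm⟩)
  rw [Graph.deleteVerts_isLink] at hf
  refine two_le_degree_of_inc_of_inc he.inc_left hf.1.inc_left ?_
  rintro rfl
  exact hf.2.2 (hf.1.right_unique he)

lemma deleteVerts_deleteVerts (G : Graph α β) (X Y : Set α) :
    (G.deleteVerts X).deleteVerts Y = G.deleteVerts (X ∪ Y) := by
  refine Graph.ext (by simp [Set.sdiff_sdiff]) fun e x y ↦ ?_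
  simp only [Graph.deleteVerts_isLink, Set.mem_union]
  tauto

lemma edgeSet_deleteVerts_singleton (G : Graph α β) (x : α) :
    E(G.deleteVerts {x}) = E(G) \ G.incidenceSet x := by
  ext e
  rw [Graph.edgeSet_deleteVerts]
  constructor
  · rintro ⟨a, b, hab, ha, hb⟩
    refine ⟨hab.edge_mem, fun (hx : G.Inc e x) ↦ ?_⟩
    rcases hx.eq_or_eq_of_isLink hab with rfl | rfl
    exacts [ha rfl, hb rfl]
  · rintro ⟨he, hx⟩
    obtain ⟨a, b, hab⟩ := Graph.exists_isLink_of_mem_edgeSet he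
    exact ⟨a, b, hab, fun h ↦ hx (h ▸ hab.inc_left), fun h ↦ hx (h ▸ hab.inc_right)⟩

lemma edgeSubgraph_eq_of_le (hHG : H ≤ G) {X : Set β} (hX : X ⊆ E(H)) :
    edgeSubgraph H X = edgeSubgraph G X := by
  refine Graph.ext ?_ fun e x y ↦ and_congr_right fun he ↦ hHG.isLink_iff (hX he)
  ext x
  exact exists_congr fun e ↦ and_congr_right fun he ↦ hHG.inc_congr (hX he)

lemma isKCircuit_iff_of_le (hHG : H ≤ G) {k : ℕ} {C : Set β} :
    IsKCircuit H k C ↔ C ⊆ E(H) ∧ IsKCircuit G k C := by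
  refine ⟨fun ⟨hC, h⟩ ↦ ⟨hC, hC.trans hHG.edgeSet_mono, ?_⟩, fun ⟨hC, _, h⟩ ↦ ⟨hC, ?_⟩⟩
  · rwa [← edgeSubgraph_eq_of_le hHG hC]
  · rwa [edgeSubgraph_eq_of_le hHG hC]

lemma ends_sdiff_incidenceSet {x : α}
    (hdeg : ∀ y ∈ V(G.deleteVerts {x}), degree (G.deleteVerts {x}) y ≠ 0) :
    ends G (E(G) \ G.incidenceSet x) = V(G) \ {x} := by
  rw [← Graph.vertexSet_deleteVerts, ← ends_edgeSet hdeg, ← edgeSet_deleteVerts_singleton]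
  exact (congrArg Graph.vertexSet (edgeSubgraph_eq_of_le Graph.deleteVerts_le subset_rfl)).symm

lemma two_le_degree_of_deleteVerts (hne : ∀ x ∈ V(G), V(G.deleteVerts {x}).Nonempty)
    (hdeg : ∀ x ∈ V(G), ∀ y ∈ V(G.deleteVerts {x}), 2 ≤ degree (G.deleteVerts {x}) y) {y : α}
    (hy : y ∈ V(G)) : 2 ≤ degree G y := by
  obtain ⟨x, hx, hxy⟩ := hne y hy
  exact (hdeg x hx y ⟨hy, fun h ↦ hxy h.symm⟩).trans (degree_mono Graph.deleteVerts_le y)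

lemma IsThreeConnected.connected (hG : IsThreeConnected G) : Connected G := by
  simpa only [Graph.deleteVerts_empty] using hG.2 ∅ (Set.empty_subset _) (by simp)

lemma IsThreeConnected.connected_deleteVerts_singleton (hG : IsThreeConnected G) {x : α}
    (hx : x ∈ V(G)) : Connected (G.deleteVerts {x}) :=
  hG.2 {x} (Set.singleton_subset_iff.2 hx) (by simp)

lemma IsThreeConnected.two_le_degree_deleteVerts_singleton (hG : IsThreeConnected G) {x y : α}
    (hx : x ∈ V(G)) (hy : y ∈ V(G.deleteVerts {x})) : 2 ≤ degree (G.deleteVerts {x}) y := by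
  refine (hG.connected_deleteVerts_singleton hx).two_le_degree (fun z hz ↦ ?_) ?_ hy
  · rw [deleteVerts_deleteVerts, Set.singleton_union]
    exact hG.2 {x, z} (Set.pair_subset hx hz.1)
      ((Set.encard_insert_le {z} x).trans (by rw [Set.encard_singleton, one_add_one_eq_two]))
  · rw [Graph.vertexSet_deleteVerts, ← ENat.add_le_add_iff_right ENat.one_ne_top,
      Set.encard_sdiff_singleton_add_one hx]
    exact hG.1

lemma kCircularMatroid_restrict_edgeSet (hHG : H ≤ G) (hG : E(G).Finite) (hH : E(H).Finite) (k : ℕ)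
    (hk : 1 ≤ k) : kCircularMatroid G hG k hk ↾ E(H) = kCircularMatroid H hH k hk := by
  refine Matroid.ext_isCircuit rfl fun C _ ↦ ?_
  rw [Matroid.restrict_isCircuit_iff hHG.edgeSet_mono, kCircularMatroid_isCircuit_iff,
    kCircularMatroid_isCircuit_iff, isKCircuit_iff_of_le hHG, and_comm]

lemma kCircularMatroid_delete_incidenceSet (G : Graph α β) (hE : E(G).Finite) {x : α}
    (hEx : E(G.deleteVerts {x}).Finite) (k : ℕ) (hk : 1 ≤ k) :
    kCircularMatroid G hE k hk ＼ G.incidenceSet x =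
      kCircularMatroid (G.deleteVerts {x}) hEx k hk := by
  rw [← kCircularMatroid_restrict_edgeSet Graph.deleteVerts_le hE, edgeSet_deleteVerts_singleton]
  rfl

end Graph

section KCircularMatroid

variable {G : Graph α β} {k : ℕ} {hE : E(G).Finite} {hk : 1 ≤ k}

instance : (kCircularMatroid G hE k hk).Finite := ⟨hE⟩

lemma kCircularMatroid_indep_iff_ncard_lt {I : Set β} : (kCircularMatroid G hE k hk).Indep I ↔
    I ⊆ E(G) ∧ ∀ X ⊆ I, X.ncard < (ends G X).ncard + k := by
  rw [kCircularMatroid_indep_iff]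
  exact and_congr_right fun hI ↦ forall_not_isKCircuit_iff hE hk hI

lemma ncard_lt_of_indep {I : Set β} (hI : (kCircularMatroid G hE k hk).Indep I) :
    I.ncard < (ends G I).ncard + k :=
  (kCircularMatroid_indep_iff_ncard_lt.1 hI).2 I subset_rfl

instance : (kCircularMatroid G hE k hk).Loopless := by
  refine Matroid.loopless_iff_forall_isCircuit.2 fun C hC ↦ ?_
  have hCE : C ⊆ E(G) := hC.subset_ground
  have hfin := hE.subset hCE
  have hends := (Set.ncard_pos (ends_finite G hfin)).2 (ends_nonempty hCE hC.nonempty)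
  have hcount := ((kCircularMatroid_isCircuit_iff ..).1 hC).count_le
  have := hfin.to_subtype
  exact Set.one_lt_ncard_iff_nontrivial.1 (by omega)

/-- A set `X` of edges is tight if it has `|V(G⟨X⟩)| + k - 1` elements, the largest number that an
independent set of `Mₖ(G)` with these ends can have. -/
def Tight (G : Graph α β) (k : ℕ) (X : Set β) : Prop :=
  X.ncard + 1 = (ends G X).ncard + k

lemma Tight.union {X Y : Set β} (hX : Tight G k X) (hY : Tight G k Y)
    (hXY : (kCircularMatroid G hE k hk).Indep (X ∪ Y)) : Tight G k (X ∪ Y) := by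
  have hfin : (X ∪ Y).Finite := hE.subset hXY.subset_ground
  have hXf := hfin.subset Set.subset_union_left
  have hYf := hfin.subset Set.subset_union_right
  have hedges := Set.ncard_union_add_ncard_inter X Y hXf hYf
  have hverts := Set.ncard_union_add_ncard_inter _ _ (ends_finite G hXf) (ends_finite G hYf)
  rw [← ends_union] at hverts
  have hinter := Set.ncard_le_ncard (Set.subset_inter (ends_mono Set.inter_subset_left)
    (ends_mono Set.inter_subset_right) : ends G (X ∩ Y) ⊆ ends G X ∩ ends G Y)
    ((ends_finite G hXf).inter_of_left _)
  have hlt_inter := ncard_lt_of_indep (hXY.subset (Set.inter_subset_left.trans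
    Set.subset_union_left : X ∩ Y ⊆ X ∪ Y))
  have hlt_union := ncard_lt_of_indep hXY
  unfold Tight at *
  omega

lemma exists_greatest_tight {I X : Set β} (hI : (kCircularMatroid G hE k hk).Indep I)
    (hXI : X ⊆ I) (hX : Tight G k X) : ∃ T ⊆ I, Tight G k T ∧ ∀ Y ⊆ I, Tight G k Y → Y ⊆ T := by
  have hIf : I.Finite := hE.subset hI.subset_ground
  have hfin : {Y | Y ⊆ I ∧ Tight G k Y}.Finite := hIf.finite_subsets.subset fun Y hY ↦ hY.1
  obtain ⟨T, hT⟩ := hfin.exists_maximal ⟨X, hXI, hX⟩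
  refine ⟨T, hT.prop.1, hT.prop.2, fun Y hYI hY ↦ ?_⟩
  have hTY : T ∪ Y ⊆ I := Set.union_subset hT.prop.1 hYI
  exact Set.subset_union_right.trans
    (hT.le_of_ge ⟨hTY, hT.prop.2.union hY (hI.subset hTY)⟩ Set.subset_union_left)

lemma IsKCircuit.tight_sdiff_singleton (hE : E(G).Finite) {C : Set β} (hC : IsKCircuit G k C)
    {e : β} (he : e ∈ C) : Tight G k (C \ {e}) ∧ ends G (C \ {e}) = ends G C := by
  have hfin := hE.subset hC.1
  have hlt := hC.count_lt hE (Set.sdiff_singleton_ssubset.2 he)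
  have hle := hC.count_le
  have hcard := Set.ncard_sdiff_singleton_add_one he hfin
  have hends := ends_mono (G := G) (Set.sdiff_subset (s := C) (t := {e}))
  have hends_card := Set.ncard_le_ncard hends (ends_finite G hfin)
  exact ⟨by unfold Tight; omega,
    Set.eq_of_subset_of_ncard_le hends (by omega) (ends_finite G hfin)⟩

lemma exists_tight_of_isBasis {F I : Set β} (hI : (kCircularMatroid G hE k hk).IsBasis I F) {e : β}
    (heF : e ∈ F) (heI : e ∉ I) : ∃ X ⊆ I, Tight G k X ∧ ends G {e} ⊆ ends G X := by
  set C := (kCircularMatroid G hE k hk).fundCircuit e I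
  have heC : e ∈ C := Matroid.mem_fundCircuit ..
  have hC : IsKCircuit G k C := (kCircularMatroid_isCircuit_iff ..).1
    (hI.indep.fundCircuit_isCircuit (hI.subset_closure heF) heI)
  obtain ⟨htight, hends⟩ := hC.tight_sdiff_singleton hE heC
  exact ⟨C \ {e}, Set.sdiff_singleton_subset_iff.2 (Matroid.fundCircuit_subset_insert ..), htight,
    hends ▸ ends_mono (Set.singleton_subset_iff.2 heC)⟩

lemma IsKCircuit.two_le_degree {C : Set β} (hC : IsKCircuit G k C) {x : α} (hx : x ∈ ends G C) :
    2 ≤ degree (edgeSubgraph G C) x := by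
  have hpos := Order.one_le_iff_pos.2 (pos_iff_ne_zero.2 (hC.2.2.1 x hx))
  rw [← one_add_one_eq_two]
  exact Order.add_one_le_of_lt (lt_of_le_of_ne hpos (hC.2.2.2.1 x hx).symm)

lemma edgeSubgraph_mono {X Y : Set β} (h : X ⊆ Y) : edgeSubgraph G X ≤ edgeSubgraph G Y where
  vertexSet_mono := ends_mono h
  isLink_mono _ _ _ he := ⟨h he.1, he.2⟩

lemma IsCyclicSet.two_le_degree {F : Set β} (hF : IsCyclicSet (kCircularMatroid G hE k hk) F)
    {x : α} (hx : x ∈ ends G F) : 2 ≤ degree (edgeSubgraph G F) x := by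
  obtain ⟨e, heF, hex⟩ := hx
  obtain ⟨C, hCF, hC, heC⟩ := hF e heF
  exact (((kCircularMatroid_isCircuit_iff ..).1 hC).two_le_degree ⟨e, heC, hex⟩).trans
    (degree_mono (edgeSubgraph_mono hCF) x)

/-- The largest tight subset `T` of the basis contains the ends of all edges outside the basis, so
the edges of `F` at the vertices not spanned by `T` all lie in `I \ T`, and there are at least as
many of these edges as of these vertices. -/
lemma IsCyclicSet.ncard_isBasis {F I : Set β} (hF : IsCyclicSet (kCircularMatroid G hE k hk) F)
    (hne : F.Nonempty) (hI : (kCircularMatroid G hE k hk).IsBasis I F) :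
    I.ncard + 1 = (ends G F).ncard + k := by
  have hFE : F ⊆ E(G) := hF.subset_ground
  have hFf := hE.subset hFE
  have hIf := hFf.subset hI.subset
  obtain ⟨e, heF, heI⟩ := Set.not_subset.1 fun h ↦ hF.not_indep hne (hI.indep.subset h)
  obtain ⟨X, hXI, hX, -⟩ := exists_tight_of_isBasis hI heF heI
  obtain ⟨T, hTI, hT, hTmax⟩ := exists_greatest_tight hI.indep hXI hX
  have hends : ∀ e ∈ F, e ∉ I \ T → ends G {e} ⊆ ends G T := fun e heF he ↦ by
    by_cases heI : e ∈ I
    · have heT : e ∈ T := by_contra fun h ↦ he ⟨heI, h⟩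
      exact ends_mono (Set.singleton_subset_iff.2 heT)
    · obtain ⟨Y, hYI, hY, heY⟩ := exists_tight_of_isBasis hI heF heI
      exact heY.trans (ends_mono (hTmax Y hYI hY))
  have hcount : (ends G F \ ends G T).ncard ≤ (I \ T).ncard := by
    refine (degree_count (G := edgeSubgraph G F) (ends_finite G hFf).sdiff hIf.sdiff
      (fun e he ↦ ⟨hFE (hI.subset he.1), hI.subset he.1⟩) (fun x hx e he ↦ ?_)
      fun x hx ↦ hF.two_le_degree hx.1).1
    obtain ⟨heF, hex⟩ := edgeSubgraph_inc.1 he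
    exact by_contra fun heIT ↦ hx.2 (hends e heF heIT ⟨e, rfl, hex⟩)
  have hedges := Set.ncard_sdiff_add_ncard_of_subset hTI hIf
  have hverts := Set.ncard_sdiff_add_ncard_of_subset (ends_mono (G := G) (hTI.trans hI.subset))
    (ends_finite G hFf)
  have hlt := ncard_lt_of_indep hI.indep
  have hle := Set.ncard_le_ncard (ends_mono (G := G) hI.subset) (ends_finite G hFf)
  unfold Tight at hT
  omega

lemma IsCyclicSet.disjoint_ends {A B : Set β} (hA : IsCyclicSet (kCircularMatroid G hE k hk) A)
    (hB : IsCyclicSet (kCircularMatroid G hE k hk) B) (hAB : Disjoint A B)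
    (h : ∀ C ⊆ A ∪ B, (kCircularMatroid G hE k hk).IsCircuit C → C ⊆ A ∨ C ⊆ B) :
    Disjoint (ends G A) (ends G B) := by
  rw [Set.disjoint_iff_inter_eq_empty]
  by_contra! hmeet
  obtain ⟨I, hI⟩ := (kCircularMatroid G hE k hk).exists_isBasis A hA.subset_ground
  obtain ⟨J, hJ⟩ := (kCircularMatroid G hE k hk).exists_isBasis B hB.subset_ground
  have hIcard := hA.ncard_isBasis (nonempty_of_ends_nonempty (hmeet.mono Set.inter_subset_left)) hI
  have hJcard := hB.ncard_isBasis (nonempty_of_ends_nonempty (hmeet.mono Set.inter_subset_right)) hJ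
  have hIJ : I ∪ J ⊆ A ∪ B := Set.union_subset_union hI.subset hJ.subset
  have hindep : (kCircularMatroid G hE k hk).Indep (I ∪ J) := by
    refine indep_union_of_forall_isCircuit hI.indep hJ.indep fun C hC hCc ↦ ?_
    refine (h C (hC.trans hIJ) hCc).imp (fun hCA e he ↦ ?_) fun hCB e he ↦ ?_
    · exact (hC he).resolve_right fun heJ ↦ hAB.notMem_of_mem_left (hCA he) (hJ.subset heJ)
    · exact (hC he).resolve_left fun heI ↦ hAB.notMem_of_mem_left (hI.subset heI) (hCB he)
  have hAf := hE.subset hA.subset_ground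
  have hBf := hE.subset hB.subset_ground
  have hcard := Set.ncard_union_eq (hAB.mono hI.subset hJ.subset) (hAf.subset hI.subset)
    (hBf.subset hJ.subset)
  have hlt := ncard_lt_of_indep hindep
  have hle := Set.ncard_le_ncard (ends_mono (G := G) hIJ) (ends_finite G (hAf.union hBf))
  have hverts := Set.ncard_union_add_ncard_inter _ _ (ends_finite G hAf) (ends_finite G hBf)
  have hpos := (Set.ncard_pos ((ends_finite G hAf).inter_of_left _)).2 hmeet
  rw [ends_union G A B] at hle
  omega

lemma isCyclicSet_edgeSet (hG : Connected G) (hdeg : ∀ x ∈ V(G), 2 ≤ degree G x)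
    (hcard : V(G).ncard + k ≤ E(G).ncard) : IsCyclicSet (kCircularMatroid G hE k hk) E(G) := by
  set M := kCircularMatroid G hE k hk
  have hV : V(G).Finite := by
    rw [← ends_edgeSet fun x hx ↦ (two_pos.trans_le (hdeg x hx)).ne']
    exact ends_finite G hE
  have hF := isCyclicSet_ground_sdiff_coloops M
  set F := M.E \ M.coloops
  have hFE : F ⊆ E(G) := hF.subset_ground
  have hFD : F ∪ M.coloops = E(G) := Set.sdiff_union_of_subset M.coloops_subset_ground
  have hDf : M.coloops.Finite := hE.subset M.coloops_subset_ground
  have hFV := ends_subset_vertexSet (G := G) F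
  have hFne : F.Nonempty := by
    by_contra! hF0
    have hlt : E(G).ncard < (ends G E(G)).ncard + k := ncard_lt_of_indep
      (by simpa only [← hFD, hF0, Set.empty_union] using M.coloops_indep)
    have hle := Set.ncard_le_ncard (ends_subset_vertexSet (G := G) E(G)) hV
    omega
  obtain ⟨I, hI⟩ := M.exists_isBasis F hF.subset_ground
  have hIcard := hF.ncard_isBasis hFne hI
  have hdisj : Disjoint I M.coloops := Set.disjoint_sdiff_left.mono_left hI.subset
  have hlt : (I ∪ M.coloops).ncard < (ends G (I ∪ M.coloops)).ncard + k :=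
    ncard_lt_of_indep (Matroid.union_coloops_indep_iff.2 hI.indep)
  have hle := Set.ncard_le_ncard (ends_subset_vertexSet (G := G) (I ∪ M.coloops)) hV
  have hunion := Set.ncard_union_eq hdisj (hE.subset (hI.subset.trans hFE)) hDf
  have hverts := Set.ncard_sdiff_add_ncard_of_subset hFV hV
  have hcount := degree_count (W := V(G) \ ends G F) hV.sdiff hDf M.coloops_subset_ground
    (fun x hx e (he : G.Inc e x) ↦ (hFD.ge he.edge_mem).resolve_left fun heF ↦ hx.2 ⟨e, heF, he⟩)
    fun x hx ↦ hdeg x hx.1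
  have hends : Disjoint (ends G F) (ends G M.coloops) :=
    Set.disjoint_right.2 fun x ⟨e, he, hex⟩ ↦ ((hcount.2 (by omega)).2 e he x hex).2
  have hcoloops : M.coloops = ∅ := by
    by_contra! hne
    exact hG.not_disjoint_ends hFD hFne hne hends
  rwa [← hFD, hcoloops, Set.union_empty]

lemma matroidConnected_kCircularMatroid_iff (hG : Connected G) (hdeg : ∀ x ∈ V(G), 2 ≤ degree G x) :
    MatroidConnected (kCircularMatroid G hE k hk) ↔ V(G).ncard + k ≤ E(G).ncard := by
  have hV : ends G E(G) = V(G) := ends_edgeSet fun x hx ↦ (two_pos.trans_le (hdeg x hx)).ne'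
  constructor
  · intro hconn
    have hcyc : IsCyclicSet (kCircularMatroid G hE k hk) E(G) := hconn.isCyclicSet_ground
    have hne : E(G).Nonempty := nonempty_of_ends_nonempty (hV ▸ hG.1)
    obtain ⟨B, hB⟩ := (kCircularMatroid G hE k hk).exists_isBase
    have hBE : B ⊆ E(G) := hB.subset_ground
    have hBne : B ≠ E(G) := by
      rintro rfl
      exact hcyc.not_indep hne hB.indep
    have hBcard := hcyc.ncard_isBasis hne hB.isBasis_ground
    have hlt := Set.ncard_lt_ncard (hBE.ssubset_of_ne hBne) hE
    rw [hV] at hBcard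
    omega
  · intro hcard
    have hcyc := isCyclicSet_edgeSet (hE := hE) (hk := hk) hG hdeg hcard
    refine matroidConnected_of_forall fun e he f hf ↦ ?_
    by_contra! hsep
    obtain ⟨A, B, hAB, heA, hfB, hdisj, hA, hB, hC⟩ := hcyc.exists_separation he hf hsep
    exact hG.not_disjoint_ends hAB ⟨e, heA⟩ ⟨f, hfB⟩ (hA.disjoint_ends hB hdisj fun C _ ↦ hC C)

lemma ncard_add_le_of_not_indep (hdeg : ∀ x ∈ V(G), 2 ≤ degree G x)
    (h : ¬ (kCircularMatroid G hE k hk).Indep E(G)) : V(G).ncard + k ≤ E(G).ncard := by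
  have hV : ends G E(G) = V(G) := ends_edgeSet fun x hx ↦ (two_pos.trans_le (hdeg x hx)).ne'
  obtain ⟨C, hCE, hC⟩ := ((kCircularMatroid G hE k hk).not_indep_iff.1 h).exists_isCircuit_subset
  have hcount := (degree_count (G := G) (W := V(G) \ ends G C) (F := E(G) \ C)
    (hV ▸ ends_finite G hE).sdiff hE.sdiff Set.sdiff_subset
    (fun x hx e he ↦ ⟨he.edge_mem, fun heC ↦ hx.2 ⟨e, heC, he⟩⟩) fun x hx ↦ hdeg x hx.1).1
  have hle := ((kCircularMatroid_isCircuit_iff ..).1 hC).count_le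
  have hedges := Set.ncard_sdiff_add_ncard_of_subset hCE hE
  have hverts := Set.ncard_sdiff_add_ncard_of_subset (ends_subset_vertexSet C)
    (hV ▸ ends_finite G hE)
  omega

lemma isBase_of_ncard_ends_le {I : Set β} (hI : (kCircularMatroid G hE k hk).Indep I)
    (hcard : (ends G E(G)).ncard + k ≤ I.ncard + 1) : (kCircularMatroid G hE k hk).IsBase I := by
  obtain ⟨B, hB, hIB⟩ := hI.exists_isBase_superset
  have hlt := ncard_lt_of_indep hB.indep
  have hle := Set.ncard_le_ncard (ends_mono (G := G) hB.subset_ground) (ends_finite G hE)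
  rw [kCircularMatroid_ground] at hle
  rwa [Set.eq_of_subset_of_ncard_le hIB (by omega) (hE.subset hB.subset_ground)]

lemma IsCyclicSet.spanning_of_ends_subset {F : Set β}
    (hF : IsCyclicSet (kCircularMatroid G hE k hk) F) (hne : F.Nonempty)
    (hends : ends G E(G) ⊆ ends G F) : (kCircularMatroid G hE k hk).Spanning F := by
  have hFf := hE.subset hF.subset_ground
  obtain ⟨I, hI⟩ := (kCircularMatroid G hE k hk).exists_isBasis F hF.subset_ground
  have hcard := hF.ncard_isBasis hne hI
  have hle := Set.ncard_le_ncard hends (ends_finite G hFf)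
  exact (isBase_of_ncard_ends_le hI.indep (by omega)).spanning_of_superset hI.subset
    hF.subset_ground

section IsCyclicSet

variable (hcyc : IsCyclicSet (kCircularMatroid G hE k hk) E(G)) (hne : E(G).Nonempty)
include hcyc hne

lemma eRank_kCircularMatroid_add_one :
    (kCircularMatroid G hE k hk).eRank + 1 = (((ends G E(G)).ncard + k : ℕ) : ℕ∞) := by
  obtain ⟨B, hB⟩ := (kCircularMatroid G hE k hk).exists_isBase
  rw [← hB.encard_eq_eRank, ← (hE.subset hB.subset_ground).cast_ncard_eq,
    ← hcyc.ncard_isBasis hne hB.isBasis_ground, Nat.cast_add_one]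

lemma ends_eq_of_spanning {F : Set β} (hF : (kCircularMatroid G hE k hk).Spanning F) :
    ends G F = ends G E(G) := by
  obtain ⟨B, hB, hBF⟩ := hF.exists_isBase_subset
  have hBE : B ⊆ E(G) := hB.subset_ground
  have hcard := hcyc.ncard_isBasis hne hB.isBasis_ground
  have hlt := ncard_lt_of_indep hB.indep
  have hends : ends G B = ends G E(G) :=
    Set.eq_of_subset_of_ncard_le (ends_mono hBE) (by omega) (ends_finite G hE)
  exact (ends_mono hF.subset_ground).antisymm (hends ▸ ends_mono hBF)

lemma not_spanning_sdiff_incidenceSet {x : α} (hx : x ∈ ends G E(G)) :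
    ¬ (kCircularMatroid G hE k hk).Spanning (E(G) \ G.incidenceSet x) := fun h ↦ by
  obtain ⟨e, he, hex⟩ := (ends_eq_of_spanning hcyc hne h).ge hx
  exact he.2 hex

lemma exists_eq_incidenceSet_of_isCocircuit {K : Set β}
    (hK : (kCircularMatroid G hE k hk).IsCocircuit K)
    (hKc : IsCyclicSet (kCircularMatroid G hE k hk) (E(G) \ K)) :
    ∃ x ∈ ends G E(G), K = G.incidenceSet x := by
  have hmin := Matroid.isCocircuit_iff_minimal_compl_nonspanning.1 hK
  obtain ⟨x, hx, hxK⟩ : ∃ x ∈ ends G E(G), x ∉ ends G (E(G) \ K) := by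
    by_contra! hends
    have hKne := nonempty_of_ends_nonempty ((ends_nonempty subset_rfl hne).mono hends)
    exact hmin.prop (hKc.spanning_of_ends_subset hKne hends)
  have hxsub : G.incidenceSet x ⊆ K := fun e (he : G.Inc e x) ↦
    by_contra fun heK ↦ hxK ⟨e, ⟨he.edge_mem, heK⟩, he⟩
  exact ⟨x, hx, hmin.eq_of_superset (not_spanning_sdiff_incidenceSet hcyc hne hx) hxsub⟩

end IsCyclicSet

lemma indep_insert_of_notMem_ends {I : Set β} (hI : (kCircularMatroid G hE k hk).Indep I) {x : α}
    (hx : x ∉ ends G I) {e : β} (he : G.Inc e x) :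
    (kCircularMatroid G hE k hk).Indep (insert e I) := by
  rw [kCircularMatroid_indep_iff_ncard_lt] at hI ⊢
  refine ⟨Set.insert_subset he.edge_mem hI.1, fun X hX ↦ ?_⟩
  by_cases heX : e ∈ X
  · have hXf := ((hE.subset hI.1).insert e).subset hX
    have hlt := hI.2 (X \ {e}) (Set.sdiff_singleton_subset_iff.2 hX)
    have hends : ends G (X \ {e}) ⊆ ends G X \ {x} := by
      rintro y ⟨f, ⟨hfX, hfe⟩, hfy⟩
      refine ⟨⟨f, hfX, hfy⟩, ?_⟩
      rintro rfl
      exact hx ⟨f, (hX hfX).resolve_left hfe, hfy⟩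
    have hle := Set.ncard_le_ncard hends (ends_finite G hXf).sdiff
    have hedges := Set.ncard_sdiff_singleton_add_one heX hXf
    have hverts := Set.ncard_sdiff_singleton_add_one (s := ends G X) ⟨e, heX, he⟩
      (ends_finite G hXf)
    omega
  · exact hI.2 X ((Set.subset_insert_iff_of_notMem heX).1 hX)

lemma isCocircuit_incidenceSet (hcyc : IsCyclicSet (kCircularMatroid G hE k hk) E(G)) {x : α}
    (hxc : IsCyclicSet (kCircularMatroid G hE k hk) (E(G) \ G.incidenceSet x))
    (hne : (E(G) \ G.incidenceSet x).Nonempty) (hx : x ∈ ends G E(G))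
    (hends : ends G E(G) \ {x} ⊆ ends G (E(G) \ G.incidenceSet x)) :
    (kCircularMatroid G hE k hk).IsCocircuit (G.incidenceSet x) := by
  rw [Matroid.isCocircuit_iff_minimal_compl_nonspanning]
  refine ⟨not_spanning_sdiff_incidenceSet hcyc (hne.mono Set.sdiff_subset) hx,
    fun S hS hSx e he ↦ by_contra fun heS ↦ hS ?_⟩
  obtain ⟨I, hI⟩ := (kCircularMatroid G hE k hk).exists_isBasis (E(G) \ G.incidenceSet x)
    Set.sdiff_subset
  have hxI : x ∉ ends G I := fun ⟨f, hfI, hfx⟩ ↦ (hI.subset hfI).2 hfx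
  have hins : insert e I ⊆ E(G) \ S := Set.insert_subset ⟨Graph.Inc.edge_mem he, heS⟩
    (hI.subset.trans (Set.sdiff_subset_sdiff_right hSx))
  have hIcard := hxc.ncard_isBasis hne hI
  have hinsert := Set.ncard_insert_of_notMem (fun h ↦ (hI.subset h).2 he)
    (hE.subset hI.indep.subset_ground)
  have hverts := Set.ncard_sdiff_singleton_add_one hx (ends_finite G hE)
  have hle := Set.ncard_le_ncard hends (ends_finite G hE.sdiff)
  exact (isBase_of_ncard_ends_le (indep_insert_of_notMem_ends hI.indep hxI he)
    (by omega)).spanning_of_superset hins Set.sdiff_subset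

lemma matroidConnected_delete_incidenceSet_iff
    (hcyc : IsCyclicSet (kCircularMatroid G hE k hk) E(G)) {x : α} (hx : x ∈ ends G E(G))
    (hends : ends G E(G) = V(G)) (hGx : Connected (G.deleteVerts {x}))
    (hdeg : ∀ y ∈ V(G.deleteVerts {x}), 2 ≤ degree (G.deleteVerts {x}) y) :
    MatroidConnected (kCircularMatroid G hE k hk ＼ G.incidenceSet x) ↔
      (G.incidenceSet x).encard ≤ (kCircularMatroid G hE k hk)✶.eRank := by
  have hEx : E(G.deleteVerts {x}).Finite := hE.subset Graph.deleteVerts_le.edgeSet_mono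
  have hverts := Set.ncard_sdiff_singleton_add_one hx (ends_finite G hE)
  rw [kCircularMatroid_delete_incidenceSet G hE hEx, matroidConnected_kCircularMatroid_iff hGx hdeg,
    encard_le_eRank_dual_iff (G.incidenceSet_subset_edgeSet x),
    ← ENat.add_le_add_iff_right ENat.one_ne_top,
    eRank_kCircularMatroid_add_one hcyc (nonempty_of_ends_nonempty ⟨x, hx⟩),
    kCircularMatroid_ground, ← edgeSet_deleteVerts_singleton, ← hEx.cast_ncard_eq,
    Graph.vertexSet_deleteVerts, ← hends, ← hverts]
  norm_cast
  omega

end KCircularMatroid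

end KCircular

open KCircular in
theorem mainTheorem7_general {α β : Type*} (G : Graph α β) (hE : E(G).Finite) (k : ℕ) (hk : 1 ≤ k)
    (hG : Connected G) (hG' : ∀ x ∈ V(G), Connected (G.deleteVerts {x}))
    (hdeg : ∀ x ∈ V(G), ∀ y ∈ V(G.deleteVerts {x}), 2 ≤ degree (G.deleteVerts {x}) y) :
    {K : Set β | IsNonseparatingCocircuit (kCircularMatroid G hE k hk) K} =
      {S : Set β | IsVertexStar G S ∧ S.encard ≤ (kCircularMatroid G hE k hk)✶.eRank} := by
  have hdegG : ∀ x ∈ V(G), 2 ≤ degree G x :=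
    fun x ↦ two_le_degree_of_deleteVerts (fun x hx ↦ (hG' x hx).1) hdeg
  have hV : ends G E(G) = V(G) := ends_edgeSet fun x hx ↦ (two_pos.trans_le (hdegG x hx)).ne'
  ext K
  constructor
  · rintro ⟨hconn, hK, hconnK⟩
    obtain ⟨x, hx, rfl⟩ := exists_eq_incidenceSet_of_isCocircuit hconn.isCyclicSet_ground
      (nonempty_of_ends_nonempty (hV ▸ hG.1)) hK hconnK.isCyclicSet_delete
    have hxV : x ∈ V(G) := hV ▸ hx
    exact ⟨⟨x, hxV, rfl⟩, (matroidConnected_delete_incidenceSet_iff hconn.isCyclicSet_ground hx hV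
      (hG' x hxV) (hdeg x hxV)).1 hconnK⟩
  · rintro ⟨⟨x, hxV, rfl⟩, hcard⟩
    have hx : x ∈ ends G E(G) := hV ▸ hxV
    have hne : (G.incidenceSet x).Nonempty := hx.imp fun _ he ↦ he.2
    have hconn : MatroidConnected (kCircularMatroid G hE k hk) :=
      (matroidConnected_kCircularMatroid_iff hG hdegG).2 (ncard_add_le_of_not_indep hdegG
        (not_indep_ground_of_encard_le_eRank_dual hne hcard))
    have hconnx := (matroidConnected_delete_incidenceSet_iff hconn.isCyclicSet_ground hx hV
      (hG' x hxV) (hdeg x hxV)).2 hcard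
    have hends := ends_sdiff_incidenceSet fun y hy ↦ (two_pos.trans_le (hdeg x hxV y hy)).ne'
    have hcocircuit := isCocircuit_incidenceSet hconn.isCyclicSet_ground hconnx.isCyclicSet_delete
      (nonempty_of_ends_nonempty ((hG' x hxV).1.mono hends.ge)) hx (hends ▸ hV ▸ subset_rfl)
    exact ⟨hconn, hcocircuit, hconnx⟩

theorem mainTheorem7 {α β : Type*} (G : Graph α β) (hV : V(G).Finite) (hE : E(G).Finite)
    (k : ℕ) (hk : 1 ≤ k) (hG : KCircular.IsThreeConnected G)
    (hΔ : (k : ℤ) ≤ (E(G).ncard : ℤ) - (V(G).ncard : ℤ)) :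
    {K : Set β | KCircular.IsNonseparatingCocircuit (KCircular.kCircularMatroid G hE k hk) K} =
      {S : Set β | KCircular.IsVertexStar G S ∧
        S.encard ≤ (KCircular.kCircularMatroid G hE k hk)✶.eRank} :=
  mainTheorem7_general G hE k hk hG.connected (fun _ ↦ hG.connected_deleteVerts_singleton)
    fun _ hx _ ↦ hG.two_le_degree_deleteVerts_singleton hx
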